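/- **Setting.** Let $A\in\mathbb R^{n\times n}$, $C\in\mathbb R^{m\times n}$, let $Q\in\mathbb R^{n\times n}$ and $R\in\mathbb R^{m\times m}$ be positive semidefinite (the process and measurement noise covariances), and put $f(X)=AXA^T+Q$. Let $P_{0|0}$ be positive semidefinite and let $$M_k=f(P_{k|k}),\qquad K_{k+1}=M_kC^T(CM_kC^T+R)^{-1},\qquad P_{k+1|k+1}=(I-K_{k+1}C)M_k$$ be the error covariances of the local Kalman filter, where all inverses are assumed to exist; assume that the filter is stable, i.e. $P_{k|k}$ converges to a finite matrix $\bar P_0$. Let $g(r)\in[0,1]$, $r\in\mathbb N_0$, be the probability that a packet is not detected in its $r$-th retransmission ($r=0$ being a new transmission), with $g(0)<1$ and $g(r)<g(0)$ for all $r>0$. Consider the Markov decision process with state space $\mathbb S=\{(r,q)\in\mathbb N_0\times\mathbb N_0: r\le q\}$, action space $\{0,1\}$ ($0$: new transmission, $1$: retransmission), and the following transitions from $(r,q)$. Under action $0$ the next state is $(0,0)$ with probability $1-g(0)$ and $(0,q+1)$ with probability $g(0)$; under action $1$ it is $(r+1,r+1)$ with probability $1-g(r+1)$ and $(r+1,q+1)$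 with probability $g(r+1)$. The one-stage cost is $c((r,q),a)=\operatorname{Tr}\big(f^{q+1}(\bar P_0)\big)$ for both actions. For a (history-dependent, randomized) policy $\pi$ and an initial state $s$ let $$J(\pi,s)=\limsup_{K\to\infty}\frac1K\sum_{k=0}^{K-1}\mathbb E^{\pi}_{s}\big[c(s_k,a_{k+1})\big]\in[0,\infty],\qquad s_0=s,$$ where $a_{k+1}$ is the action taken in the state $s_k$; this is the long-term average mean-square estimation error. **Theorem.** Let $1-\lambda'=\sup_{r>0}g(r)$ and let $\rho(A)$ be the spectral radius of $A$. If $(1-\lambda')\,\rho^2(A)<1$, then there is a stationary deterministic policy $\pi^*:\mathbb S\to\{0,1\}$ that is optimal, i.e. $J(\pi^*,s)\le J(\pi,s)$ for every initial state $s\in\mathbb S$ and every policy $\pi$, and that has bounded average cost: there is $B<\infty$ with $J(\pi^*,s)\le B$ for all $s\in\mathbb S$. -/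

import Mathlib

open Filter Topology
open scoped ENNReal NNReal unitInterval

namespace HARQ

noncomputable section

/-! ## The dynamic process and the local Kalman filter -/

/-- The prediction operator `f(X) = A X Aᵀ + Q`. -/
def predict {n : ℕ} (A Q X : Matrix (Fin n) (Fin n) ℝ) : Matrix (Fin n) (Fin n) ℝ :=
  A * X * A.transpose + Q

/-- The innovation covariance `C M Cᵀ + R`, where `M = f(P)` is the a priori error covariance
obtained from the previous a posteriori error covariance `P`. -/
def innovationCov {n m : ℕ} (A : Matrix (Fin n) (Fin n) ℝ) (C : Matrix (Fin m) (Fin n) ℝ)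
    (Q : Matrix (Fin n) (Fin n) ℝ) (R : Matrix (Fin m) (Fin m) ℝ)
    (P : Matrix (Fin n) (Fin n) ℝ) : Matrix (Fin m) (Fin m) ℝ :=
  C * predict A Q P * C.transpose + R

/-- The Kalman gain `K = M Cᵀ (C M Cᵀ + R)⁻¹`, where `M = f(P)`. -/
def kalmanGain {n m : ℕ} (A : Matrix (Fin n) (Fin n) ℝ) (C : Matrix (Fin m) (Fin n) ℝ)
    (Q : Matrix (Fin n) (Fin n) ℝ) (R : Matrix (Fin m) (Fin m) ℝ)
    (P : Matrix (Fin n) (Fin n) ℝ) : Matrix (Fin n) (Fin m) ℝ :=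
  predict A Q P * C.transpose * (innovationCov A C Q R P)⁻¹

/-- The a posteriori error covariance `P_{k|k}` of the Kalman filter, started from `P_{0|0} = S`:
`P_{k+1|k+1} = (I - K C) f(P_{k|k})`. -/
def kalmanCov {n m : ℕ} (A : Matrix (Fin n) (Fin n) ℝ) (C : Matrix (Fin m) (Fin n) ℝ)
    (Q : Matrix (Fin n) (Fin n) ℝ) (R : Matrix (Fin m) (Fin m) ℝ)
    (S : Matrix (Fin n) (Fin n) ℝ) : ℕ → Matrix (Fin n) (Fin n) ℝ
  | 0 => S
  | k + 1 =>
      (1 - kalmanGain A C Q R (kalmanCov A C Q R S k) * C) *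
        predict A Q (kalmanCov A C Q R S k)

/-- The spectral radius `ρ(A)`: the largest modulus of a complex eigenvalue of the real
matrix `A`. -/
def specRadius {n : ℕ} (A : Matrix (Fin n) (Fin n) ℝ) : ℝ :=
  (spectralRadius ℂ (A.map (fun x : ℝ => (x : ℂ)))).toReal

/-! ## The Markov decision process -/

/-- The states `(r, q)` with `r ≤ q`: the number `r` of consecutive retransmissions and the
estimation quality index `q`. -/
abbrev State : Type := {p : ℕ × ℕ // p.1 ≤ p.2}

/-- The actions: `0` is a new transmission, `1` is a retransmission. -/
abbrev Action : Type := Fin 2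

/-- The law of a detection outcome with failure probability `p`: `true` (failure) has
probability `p` and `false` (success) has probability `1 - p`. -/
def failureLaw (p : I) : PMF Bool :=
  PMF.ofFintype
    (fun b => if b then (unitInterval.toNNReal p : ℝ≥0∞)
      else (unitInterval.toNNReal (unitInterval.symm p) : ℝ≥0∞))
    (by
      rw [Fintype.sum_bool]
      simp only [if_true, Bool.false_eq_true, if_false]
      rw [← ENNReal.coe_add, unitInterval.toNNReal_add_toNNReal_symm, ENNReal.coe_one])

/-- The number of consecutive retransmissions in the next slot: `0` after the action `0`, and
`r + 1` after the action `1`. -/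
def nextR (s : State) (a : Action) : ℕ :=
  if a = 0 then 0 else s.1.1 + 1

/-- The retransmission count of the next slot is at most `q + 1`. -/
theorem nextR_le (s : State) (a : Action) : nextR s a ≤ s.1.2 + 1 := by
  have h := s.2
  unfold nextR
  split_ifs <;> omega

/-- The next state `(r', q')`, where `q' = q + 1` after a failed detection and `q' = r'` after a
successful one. -/
def nextState (s : State) (a : Action) (failed : Bool) : State :=
  if failed then ⟨(nextR s a, s.1.2 + 1), nextR_le s a⟩
  else ⟨(nextR s a, nextR s a), le_refl _⟩

/-- The transition law: the detection fails with probability `g r'`, where `r'` is the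
retransmission count of the slot. -/
def transLaw (g : ℕ → I) (s : State) (a : Action) : PMF State :=
  (failureLaw (g (nextR s a))).map (nextState s a)

/-- The one-stage cost `Tr (f^{q+1}(P₀))` in the state `(r, q)`; the matrix is positive
semidefinite for an error covariance `P₀`, so that the cost is a nonnegative number. -/
def cost {n : ℕ} (A Q P₀ : Matrix (Fin n) (Fin n) ℝ) (s : State) : ℝ≥0∞ :=
  ENNReal.ofReal (((predict A Q)^[s.1.2 + 1] P₀).trace)

/-- A policy, possibly history dependent and randomized: it maps the list of past states and
actions (the oldest first) and the current state to the law of the next action. -/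
abbrev Policy : Type := List (State × Action) → State → PMF Action

/-- The policy that always takes the action `d s` in the state `s` (a stationary and
deterministic policy). -/
def stationary (d : State → Action) : Policy :=
  fun _ s => PMF.pure (d s)

/-- The joint law of the history and the current state after `k` slots under the policy `π`,
started in the state `s`. -/
def historyLaw (g : ℕ → I) (π : Policy) (s : State) : ℕ → PMF (List (State × Action) × State)
  | 0 => PMF.pure ([], s)
  | k + 1 =>
      (historyLaw g π s k).bind fun x =>
        (π x.1 x.2).bind fun a =>
          (transLaw g x.2 a).map fun s' => (x.1 ++ [(x.2, a)], s')

/-- The law of the state after `k` slots. -/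
def stateLaw (g : ℕ → I) (π : Policy) (s : State) (k : ℕ) : PMF State :=
  (historyLaw g π s k).map Prod.snd

/-- The expected one-stage cost after `k` slots. -/
def expCost {n : ℕ} (A Q P₀ : Matrix (Fin n) (Fin n) ℝ) (g : ℕ → I) (π : Policy) (s : State)
    (k : ℕ) : ℝ≥0∞ :=
  ∑' s' : State, stateLaw g π s k s' * cost A Q P₀ s'

/-- The long-term average cost (possibly infinite) of the policy `π` from the initial state `s`:
the limit superior of the expected average cost over the first `K` slots. -/
def avgCost {n : ℕ} (A Q P₀ : Matrix (Fin n) (Fin n) ℝ) (g : ℕ → I) (π : Policy) (s : State) :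
    ℝ≥0∞ :=
  limsup (fun K : ℕ => (∑ k ∈ Finset.range K, expCost A Q P₀ g π s k) / (K : ℝ≥0∞)) atTop

end

end HARQ

namespace HARQ

noncomputable section

/-! The proof is the vanishing-discount method. Discounted values `V_β` are centred at the state
`(0,0)`, and the relative values `V_β - V_β(origin)` are squeezed between `0` and a finite function
`W` that does not depend on `β`. Since `(1-β) V_β(origin) ≤ W origin`, a limit `β → 1` gives `G` and
`h` with `G + h = c + min_a E h`. Telescoping along a minimizing action `d` shows that its average
cost is at most `G` (`sum_stateMean_stationary_le`); an Abelian comparison shows that no policy does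
better (`discounted_sum_le`). This is `exists_optimal_stationary`.

Two facts about the model are needed. The origin minimizes every `V_β` (`finValue_origin_le`),
because the cost is monotone in `q`: the filter satisfies `P_{k+1|k+1} ≤ f(P_{k|k})`, so in the
limit `f(P₀) - P₀` is positive semidefinite. The function `W` bounds the expected cost until the
origin is reached when one retransmits until a success and then transmits anew
(`exists_drift_function`). It is finite because the cost grows at most like `b^(2q)` for some `b >
ρ(A)` with `(1-λ') b² < 1`, by Gelfand's formula. -/

/-! ## Expectations of extended nonnegative functions -/

/-- The expectation of a function with values in `[0, ∞]` under a discrete law. -/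
def expect {α : Type*} (p : PMF α) (F : α → ℝ≥0∞) : ℝ≥0∞ := ∑' x, p x * F x

theorem expect_pure {α : Type*} (x : α) (F : α → ℝ≥0∞) : expect (PMF.pure x) F = F x := by
  unfold expect
  rw [tsum_eq_single x]
  · simp
  · intro y hy
    simp [PMF.pure_apply, hy]

theorem expect_bind {α β : Type*} (p : PMF α) (f : α → PMF β) (F : β → ℝ≥0∞) :
    expect (p.bind f) F = expect p fun x => expect (f x) F := by
  unfold expect
  simp only [PMF.bind_apply, ← ENNReal.tsum_mul_right, ← ENNReal.tsum_mul_left]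
  rw [ENNReal.tsum_comm]
  simp only [mul_assoc]

theorem expect_map {α β : Type*} (p : PMF α) (f : α → β) (F : β → ℝ≥0∞) :
    expect (p.map f) F = expect p (F ∘ f) := by
  rw [PMF.map, expect_bind]
  simp only [Function.comp_apply, expect_pure]
  rfl

theorem expect_mono {α : Type*} (p : PMF α) {F F' : α → ℝ≥0∞} (h : ∀ x, F x ≤ F' x) :
    expect p F ≤ expect p F' :=
  ENNReal.tsum_le_tsum fun x => mul_le_mul_right (h x) _

theorem expect_add {α : Type*} (p : PMF α) (F F' : α → ℝ≥0∞) :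
    expect p (fun x => F x + F' x) = expect p F + expect p F' := by
  simp only [expect, mul_add, ENNReal.tsum_add]

theorem expect_const {α : Type*} (p : PMF α) (t : ℝ≥0∞) : expect p (fun _ => t) = t := by
  simp only [expect, ENNReal.tsum_mul_right, p.tsum_coe, one_mul]

theorem expect_const_mul {α : Type*} (p : PMF α) (t : ℝ≥0∞) (F : α → ℝ≥0∞) :
    expect p (fun x => t * F x) = t * expect p F := by
  simp only [expect, ← ENNReal.tsum_mul_left, mul_left_comm]

/-! ## One-step transitions -/

/-- The probability that a detection fails, when the retransmission count of the slot is `r`. -/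
def failProb (g : ℕ → I) (r : ℕ) : ℝ≥0∞ := (unitInterval.toNNReal (g r) : ℝ≥0∞)

/-- The probability that a detection succeeds, when the retransmission count of the slot is `r`. -/
def succProb (g : ℕ → I) (r : ℕ) : ℝ≥0∞ :=
  (unitInterval.toNNReal (unitInterval.symm (g r)) : ℝ≥0∞)

theorem succProb_add_failProb (g : ℕ → I) (r : ℕ) : succProb g r + failProb g r = 1 := by
  rw [succProb, failProb, add_comm, ← ENNReal.coe_add, unitInterval.toNNReal_add_toNNReal_symm,
    ENNReal.coe_one]

theorem succProb_ne_top (g : ℕ → I) (r : ℕ) : succProb g r ≠ ∞ := ENNReal.coe_ne_top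

theorem failProb_ne_top (g : ℕ → I) (r : ℕ) : failProb g r ≠ ∞ := ENNReal.coe_ne_top

/-- The expectation of `F` at the next state, after the action `a` in the state `s`. -/
def stepMean (g : ℕ → I) (F : State → ℝ≥0∞) (s : State) (a : Action) : ℝ≥0∞ :=
  succProb g (nextR s a) * F (nextState s a false) + failProb g (nextR s a) * F (nextState s a true)

theorem expect_transLaw (g : ℕ → I) (F : State → ℝ≥0∞) (s : State) (a : Action) :
    expect (transLaw g s a) F = stepMean g F s a := by
  rw [transLaw, expect_map, expect, tsum_bool]
  simp [stepMean, failureLaw, succProb, failProb]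

theorem stepMean_mono (g : ℕ → I) {F F' : State → ℝ≥0∞} (h : ∀ s, F s ≤ F' s) (s : State)
    (a : Action) : stepMean g F s a ≤ stepMean g F' s a := by
  unfold stepMean
  gcongr <;> apply h

theorem stepMean_add (g : ℕ → I) (F F' : State → ℝ≥0∞) (s : State) (a : Action) :
    stepMean g (fun x => F x + F' x) s a = stepMean g F s a + stepMean g F' s a := by
  unfold stepMean
  ring

theorem stepMean_const (g : ℕ → I) (t : ℝ≥0∞) (s : State) (a : Action) :
    stepMean g (fun _ => t) s a = t := by
  rw [stepMean, ← add_mul, succProb_add_failProb, one_mul]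

theorem stepMean_const_add (g : ℕ → I) (t : ℝ≥0∞) (F : State → ℝ≥0∞) (s : State) (a : Action) :
    stepMean g (fun x => t + F x) s a = t + stepMean g F s a := by
  rw [stepMean_add, stepMean_const]

theorem tendsto_stepMean {ι : Type*} {l : Filter ι} (g : ℕ → I) {F : ι → State → ℝ≥0∞}
    {F' : State → ℝ≥0∞} (h : ∀ s, Tendsto (fun i => F i s) l (𝓝 (F' s))) (s : State)
    (a : Action) : Tendsto (fun i => stepMean g (F i) s a) l (𝓝 (stepMean g F' s a)) :=
  (ENNReal.Tendsto.const_mul (h _) (Or.inr (succProb_ne_top g _))).add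
    (ENNReal.Tendsto.const_mul (h _) (Or.inr (failProb_ne_top g _)))

/-- The expectation of `F` at the state after `k` slots. -/
def stateMean (g : ℕ → I) (π : Policy) (s : State) (k : ℕ) (F : State → ℝ≥0∞) : ℝ≥0∞ :=
  expect (historyLaw g π s k) fun x => F x.2

theorem stateMean_zero (g : ℕ → I) (π : Policy) (s : State) (F : State → ℝ≥0∞) :
    stateMean g π s 0 F = F s := by
  rw [stateMean, historyLaw, expect_pure]

theorem stateMean_succ (g : ℕ → I) (π : Policy) (s : State) (k : ℕ) (F : State → ℝ≥0∞) :
    stateMean g π s (k + 1) F =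
      expect (historyLaw g π s k) fun x => expect (π x.1 x.2) (stepMean g F x.2) := by
  rw [stateMean, historyLaw, expect_bind]
  congr 1
  funext x
  rw [expect_bind]
  congr 1
  funext a
  rw [expect_map, ← expect_transLaw]
  rfl

theorem stateMean_stationary_succ (g : ℕ → I) (d : State → Action) (s : State) (k : ℕ)
    (F : State → ℝ≥0∞) :
    stateMean g (stationary d) s (k + 1) F =
      stateMean g (stationary d) s k fun s' => stepMean g F s' (d s') := by
  rw [stateMean_succ, stateMean]
  simp only [stationary, expect_pure]

theorem expCost_eq_stateMean {n : ℕ} (A Q P₀ : Matrix (Fin n) (Fin n) ℝ) (g : ℕ → I)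
    (π : Policy) (s : State) (k : ℕ) :
    expCost A Q P₀ g π s k = stateMean g π s k (cost A Q P₀) := by
  change expect (stateLaw g π s k) _ = _
  rw [stateLaw, expect_map]
  rfl

/-! ## Discounted values -/

/-- The smaller one of the expectations of `F` at the next state under the two actions. -/
def bestMean (g : ℕ → I) (F : State → ℝ≥0∞) (s : State) : ℝ≥0∞ :=
  min (stepMean g F s 0) (stepMean g F s 1)

theorem bestMean_le (g : ℕ → I) (F : State → ℝ≥0∞) (s : State) (a : Action) :
    bestMean g F s ≤ stepMean g F s a := by
  fin_cases a
  · exact min_le_left _ _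
  · exact min_le_right _ _

theorem exists_stepMean_eq_bestMean (g : ℕ → I) (F : State → ℝ≥0∞) (s : State) :
    ∃ a, stepMean g F s a = bestMean g F s := by
  rcases min_choice (stepMean g F s 0) (stepMean g F s 1) with h | h
  · exact ⟨0, h.symm⟩
  · exact ⟨1, h.symm⟩

theorem bestMean_mono (g : ℕ → I) {F F' : State → ℝ≥0∞} (h : ∀ s, F s ≤ F' s) (s : State) :
    bestMean g F s ≤ bestMean g F' s :=
  min_le_min (stepMean_mono g h s 0) (stepMean_mono g h s 1)

theorem bestMean_const_add (g : ℕ → I) (t : ℝ≥0∞) (F : State → ℝ≥0∞) (s : State) :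
    bestMean g (fun x => t + F x) s = t + bestMean g F s := by
  rw [bestMean, stepMean_const_add, stepMean_const_add, min_add_add_left, bestMean]

theorem tendsto_bestMean {ι : Type*} {l : Filter ι} (g : ℕ → I) {F : ι → State → ℝ≥0∞}
    {F' : State → ℝ≥0∞} (h : ∀ s, Tendsto (fun i => F i s) l (𝓝 (F' s))) (s : State) :
    Tendsto (fun i => bestMean g (F i) s) l (𝓝 (bestMean g F' s)) :=
  (tendsto_stepMean g h s 0).min (tendsto_stepMean g h s 1)

/-- The least expected discounted cost over `N` slots, by value iteration. -/
def finValue (g : ℕ → I) (c : State → ℝ≥0∞) (β : ℝ≥0∞) : ℕ → State → ℝ≥0∞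
  | 0 => fun _ => 0
  | N + 1 => fun s => c s + β * bestMean g (finValue g c β N) s

theorem finValue_le_succ (g : ℕ → I) (c : State → ℝ≥0∞) (β : ℝ≥0∞) (N : ℕ) (s : State) :
    finValue g c β N s ≤ finValue g c β (N + 1) s := by
  induction N generalizing s with
  | zero => exact zero_le
  | succ N ih =>
    change c s + β * _ ≤ c s + β * _
    gcongr
    exact bestMean_mono g ih s

/-- The least expected discounted cost over all slots. -/
def value (g : ℕ → I) (c : State → ℝ≥0∞) (β : ℝ≥0∞) (s : State) : ℝ≥0∞ :=
  ⨆ N, finValue g c β N s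

theorem tendsto_finValue (g : ℕ → I) (c : State → ℝ≥0∞) (β : ℝ≥0∞) (s : State) :
    Tendsto (fun N => finValue g c β N s) atTop (𝓝 (value g c β s)) :=
  tendsto_atTop_iSup (monotone_nat_of_le_succ fun N => finValue_le_succ g c β N s)

/-- Bellman's equation passes from finite horizons to the limit because only two actions and two
outcomes occur, so that all operations are continuous. -/
theorem value_eq (g : ℕ → I) (c : State → ℝ≥0∞) {β : ℝ≥0∞} (hβ : β ≠ ∞) (s : State) :
    value g c β s = c s + β * bestMean g (value g c β) s :=
  tendsto_nhds_unique ((tendsto_finValue g c β s).comp (tendsto_add_atTop_nat 1))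
    (tendsto_const_nhds.add
      (ENNReal.Tendsto.const_mul (tendsto_bestMean g (tendsto_finValue g c β) s) (Or.inr hβ)))

/-- Verification by dynamic programming: following `π` for `j` slots and acting optimally afterwards
cannot beat the optimum. A randomized choice is an average over actions, hence at least the minimum.
-/
theorem finValue_add_le (g : ℕ → I) (c : State → ℝ≥0∞) (β : ℝ≥0∞) (π : Policy) (s : State)
    (j N : ℕ) :
    finValue g c β (j + N) s ≤ ∑ k ∈ Finset.range j, β ^ k * stateMean g π s k c +
      β ^ j * stateMean g π s j (finValue g c β N) := by
  induction j generalizing N with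
  | zero => simp [stateMean_zero]
  | succ j ih =>
    rw [add_right_comm, add_assoc]
    refine (ih (N + 1)).trans ?_
    rw [Finset.sum_range_succ, add_assoc]
    gcongr
    rw [pow_succ, mul_assoc, ← mul_add]
    gcongr
    rw [stateMean_succ, ← expect_const_mul, stateMean, stateMean, ← expect_add]
    refine expect_mono _ fun x => ?_
    change c x.2 + β * _ ≤ _
    gcongr
    rw [← expect_const (π x.1 x.2) (bestMean g (finValue g c β N) x.2)]
    exact expect_mono _ fun a => bestMean_le _ _ _ _

theorem finValue_le_sum (g : ℕ → I) (c : State → ℝ≥0∞) (β : ℝ≥0∞) (π : Policy) (s : State)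
    (N : ℕ) :
    finValue g c β N s ≤ ∑ k ∈ Finset.range N, β ^ k * stateMean g π s k c := by
  refine (finValue_add_le g c β π s N 0).trans ?_
  have : stateMean g π s N (finValue g c β 0) = 0 := expect_const _ 0
  rw [this, mul_zero, add_zero]

/-! ## Abelian comparison -/

/-- Summation by parts; `key` carries the boundary term, which is nonpositive, to make the induction
close. -/
theorem sum_mul_le_of_antitone {w u : ℕ → ℝ} {D : ℝ} (hw : Antitone w)
    (hu : ∀ N, ∑ k ∈ Finset.range N, u k ≤ D) (hw0 : ∀ k, 0 ≤ w k) (N : ℕ) :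
    ∑ k ∈ Finset.range N, w k * u k ≤ w 0 * D := by
  have key : ∑ k ∈ Finset.range N, w k * u k ≤
      w 0 * D + w N * (∑ k ∈ Finset.range N, u k - D) := by
    induction N with
    | zero => simp
    | succ N ih =>
      have h1 := hu (N + 1)
      have h2 : w (N + 1) ≤ w N := hw N.le_succ
      rw [Finset.sum_range_succ] at h1 ⊢
      rw [Finset.sum_range_succ]
      nlinarith [mul_nonneg (sub_nonneg.2 h2) (sub_nonneg.2 h1)]
  have := mul_nonneg (hw0 N) (sub_nonneg.2 (hu N))
  linarith

/-- If the partial sums of `e` grow at most linearly with slope `t`, then so do the discounted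
sums. -/
theorem discounted_sum_le {e : ℕ → ℝ≥0∞} {t D : ℝ≥0}
    (he : ∀ N : ℕ, ∑ k ∈ Finset.range N, e k ≤ D + N * t) {β ε : ℝ≥0} (hβ : β + ε = 1) (N : ℕ) :
    ε * ∑ k ∈ Finset.range N, (β : ℝ≥0∞) ^ k * e k ≤ ε * D + t := by
  have hfin : ∀ k, e k ≠ ∞ := fun k => by
    refine ne_top_of_le_ne_top ?_
      ((Finset.single_le_sum (fun _ _ => zero_le) (Finset.self_mem_range_succ k)).trans
        (he (k + 1)))
    finiteness
  lift e to ℕ → ℝ≥0 using hfin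
  beta_reduce at he ⊢
  have he' : ∀ N : ℕ, ∑ k ∈ Finset.range N, e k ≤ D + N * t := fun N => by exact_mod_cast he N
  suffices h : ε * ∑ k ∈ Finset.range N, β ^ k * e k ≤ ε * D + t by exact_mod_cast h
  rw [← NNReal.coe_le_coe]
  push_cast
  have hβ' : (β : ℝ) + ε = 1 := by exact_mod_cast hβ
  have hβ1 : (β : ℝ) ≤ 1 := by linarith [ε.coe_nonneg]
  -- Centring at `t` turns linear growth into partial sums bounded by `D`.
  have h1 := sum_mul_le_of_antitone (w := fun k => (β : ℝ) ^ k) (u := fun k => (e k : ℝ) - t)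
    (D := D) (pow_right_anti₀ β.coe_nonneg hβ1) (fun N => by
      have : (∑ k ∈ Finset.range N, (e k : ℝ)) ≤ D + N * t := by exact_mod_cast he' N
      rw [Finset.sum_sub_distrib]
      simp
      linarith) (fun k => by positivity) N
  have h2 : (ε : ℝ) * ∑ k ∈ Finset.range N, (β : ℝ) ^ k ≤ 1 := by
    have := geom_sum_mul (β : ℝ) N
    have h3 : (0 : ℝ) ≤ (β : ℝ) ^ N := by positivity
    have h4 : (ε : ℝ) = 1 - β := by linarith
    rw [h4]
    linarith
  simp only [mul_sub, Finset.sum_sub_distrib, ← Finset.sum_mul, pow_zero, one_mul] at h1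
  have h5 := mul_le_mul_of_nonneg_left h1 ε.coe_nonneg
  have h6 := mul_le_mul_of_nonneg_right h2 t.coe_nonneg
  nlinarith

/-! ## The average cost optimality equation -/

/-- The state `(0, 0)` after a successful new transmission. -/
def origin : State := ⟨(0, 0), le_refl _⟩

theorem stepMean_le {g : ℕ → I} {F : State → ℝ≥0∞} {s : State} {a : Action} {t : ℝ≥0∞}
    (h : ∀ b, F (nextState s a b) ≤ t) : stepMean g F s a ≤ t := by
  rw [← stepMean_const g t s a, stepMean, stepMean]
  gcongr <;> apply h

theorem le_stepMean {g : ℕ → I} {F : State → ℝ≥0∞} {s : State} {a : Action} {t : ℝ≥0∞}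
    (h : ∀ b, t ≤ F (nextState s a b)) : t ≤ stepMean g F s a := by
  rw [← stepMean_const g t s a, stepMean, stepMean]
  gcongr <;> apply h

/-- If `W` decreases on average by the one-stage cost until the visit to the origin, under a
suitable choice of actions, then it bounds the relative values. -/
theorem finValue_le_add_origin {g : ℕ → I} {c W : State → ℝ≥0∞} {β : ℝ≥0∞} (hβ : β ≤ 1)
    (hW : ∀ s, ∃ a, c s + stepMean g (Function.update W origin 0) s a ≤ W s) (N : ℕ) (s : State) :
    finValue g c β N s ≤ W s + finValue g c β N origin := by
  induction N generalizing s with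
  | zero => exact zero_le
  | succ N ih =>
    obtain ⟨a, ha⟩ := hW s
    have h1 : ∀ s', finValue g c β N s' ≤
        finValue g c β N origin + Function.update W origin 0 s' := by
      intro s'
      by_cases hs : s' = origin
      · simp [hs]
      · rw [Function.update_of_ne hs, add_comm]
        exact ih s'
    calc c s + β * bestMean g (finValue g c β N) s
        ≤ c s + 1 * stepMean g (fun s' => finValue g c β N origin +
            Function.update W origin 0 s') s a := by
          gcongr
          exact (bestMean_le g _ s a).trans (stepMean_mono g h1 s a)
      _ ≤ W s + finValue g c β N origin := by
          rw [one_mul, stepMean_const_add, ← add_assoc, add_right_comm]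
          gcongr
      _ ≤ W s + finValue g c β (N + 1) origin := by
          gcongr
          exact finValue_le_succ g c β N origin

/-- Renewal at the origin: one cycle costs at most `W origin`, so the scaled value `y_N` satisfies
`y_{N+1} ≤ ε W + β y_N` at the origin, and `W origin` is the fixed point of this recursion. -/
theorem mul_finValue_origin_le {g : ℕ → I} {c W : State → ℝ≥0∞} {β ε : ℝ≥0∞} (hβ : β + ε = 1)
    (hW : ∀ s, ∃ a, c s + stepMean g (Function.update W origin 0) s a ≤ W s) (N : ℕ) :
    ε * finValue g c β N origin ≤ W origin := by
  have hβ1 : β ≤ 1 := hβ ▸ le_self_add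
  induction N with
  | zero => simp [finValue]
  | succ N ih =>
    obtain ⟨a, ha⟩ := hW origin
    have h1 : ∀ s', finValue g c β N s' ≤
        finValue g c β N origin + Function.update W origin 0 s' := by
      intro s'
      by_cases hs : s' = origin
      · simp [hs]
      · rw [Function.update_of_ne hs, add_comm]
        exact finValue_le_add_origin hβ1 hW N s'
    calc ε * (c origin + β * bestMean g (finValue g c β N) origin)
        ≤ ε * (c origin + β * (finValue g c β N origin +
            stepMean g (Function.update W origin 0) origin a)) := by
          gcongr
          rw [← stepMean_const_add]
          exact (bestMean_le g _ _ a).trans (stepMean_mono g h1 _ a)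
      _ ≤ ε * (c origin + (β * finValue g c β N origin +
            1 * stepMean g (Function.update W origin 0) origin a)) := by
          rw [mul_add β]
          gcongr
      _ = ε * (c origin + stepMean g (Function.update W origin 0) origin a) +
            β * (ε * finValue g c β N origin) := by ring
      _ ≤ ε * W origin + β * W origin := by gcongr
      _ = W origin := by rw [← add_mul, add_comm, hβ, one_mul]

/-- The average cost optimality equation, by the limit of relative discounted values, with the
bound on the optimal average cost by discounted values. -/
theorem exists_optimality_equation {g : ℕ → I} {c W : State → ℝ≥0∞}
    (hmin : ∀ (β : ℝ≥0∞) (N : ℕ) (s : State), finValue g c β N origin ≤ finValue g c β N s)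
    (hW : ∀ s, ∃ a, c s + stepMean g (Function.update W origin 0) s a ≤ W s)
    (hfin : ∀ s, W s ≠ ∞) :
    ∃ (G : ℝ≥0∞) (h : State → ℝ≥0∞), G ≤ W origin ∧ (∀ s, h s ≤ W s) ∧
      (∀ s, G + h s = c s + bestMean g h s) ∧
      ∀ (s : State) (D t : ℝ≥0), (∀ (β ε : ℝ≥0) (N : ℕ), β + ε = 1 →
        ε * finValue g c β N s ≤ ε * D + t) → G ≤ t := by
  let ε : ℕ → ℝ≥0 := fun n => ((n : ℝ≥0) + 1)⁻¹
  have hε1 : ∀ n, ε n ≤ 1 := fun n => inv_le_one_of_one_le₀ (by simp)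
  have hε0 : ∀ n, ε n ≠ 0 := fun n => by positivity
  let β : ℕ → ℝ≥0 := fun n => 1 - ε n
  have hβ : ∀ n, β n + ε n = 1 := fun n => tsub_add_cancel_of_le (hε1 n)
  have hβ' : ∀ n, (β n : ℝ≥0∞) + ε n = 1 := fun n => by exact_mod_cast hβ n
  have hβ1 : ∀ n, (β n : ℝ≥0∞) ≤ 1 := fun n => hβ' n ▸ le_self_add
  have lim_ε : Tendsto ε atTop (𝓝 0) := by
    refine NNReal.tendsto_coe.1 ?_
    refine (tendsto_one_div_add_atTop_nhds_zero_nat (𝕜 := ℝ)).congr fun n => ?_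
    simp [ε]
  have lim_β : Tendsto β atTop (𝓝 1) := by
    simpa using (tendsto_const_nhds (x := (1 : ℝ≥0))).sub lim_ε
  -- By compactness of `[0,∞]`, one ultrafilter makes the relative values converge at all states
  -- simultaneously, replacing a diagonal subsequence.
  let l : Ultrafilter ℕ := hyperfilter ℕ
  have hl : (l : Filter ℕ) ≤ atTop := Nat.hyperfilter_le_atTop
  have lim_ε' : Tendsto (fun n => (ε n : ℝ≥0∞)) l (𝓝 0) := by
    exact (ENNReal.tendsto_coe.2 lim_ε).mono_left hl
  have lim_β' : Tendsto (fun n => (β n : ℝ≥0∞)) l (𝓝 1) := by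
    exact (ENNReal.tendsto_coe.2 lim_β).mono_left hl
  have hlim : ∀ u : ℕ → ℝ≥0∞, ∃ x, Tendsto u l (𝓝 x) := fun u =>
    ⟨(l.map u).lim, (l.map u).le_nhds_lim⟩
  let V : ℕ → State → ℝ≥0∞ := fun n => value g c (β n)
  have hVmin : ∀ n s, V n origin ≤ V n s := fun n s => iSup_mono fun N => hmin _ N s
  have hVle : ∀ n s, V n s ≤ V n origin + W s := fun n s => iSup_le fun N => by
    rw [add_comm]
    refine (finValue_le_add_origin (hβ1 n) hW N s).trans ?_
    gcongr
    exact le_iSup (fun N => finValue g c (β n) N origin) N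
  have hV0 : ∀ n, ε n * V n origin ≤ W origin := fun n => by
    change _ * (⨆ N, _) ≤ _
    rw [ENNReal.mul_iSup]
    exact iSup_le fun N => mul_finValue_origin_le (hβ' n) hW N
  have hVtop : ∀ n, V n origin ≠ ∞ := fun n htop => by
    have := hV0 n
    rw [htop, ENNReal.mul_top (by exact_mod_cast hε0 n), top_le_iff] at this
    exact hfin _ this
  let u : ℕ → State → ℝ≥0∞ := fun n s => V n s - V n origin
  have hu : ∀ n s, V n origin + u n s = V n s := fun n s => add_tsub_cancel_of_le (hVmin n s)
  have huW : ∀ n s, u n s ≤ W s := fun n s => tsub_le_iff_left.2 (hVle n s)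
  -- Bellman's equation minus `β V(origin)`, which is finite and hence cancellable in `[0,∞]`.
  have heq : ∀ n s, ε n * V n origin + u n s = c s + β n * bestMean g (u n) s := fun n s => by
    have h1 : V n s = c s + β n * bestMean g (V n) s := value_eq g c ENNReal.coe_ne_top s
    have h2 : V n = fun s => V n origin + u n s := funext fun s => (hu n s).symm
    rw [congrArg (bestMean g · s) h2, bestMean_const_add] at h1
    have h3 : β n * V n origin ≠ ∞ := ENNReal.mul_ne_top ENNReal.coe_ne_top (hVtop n)
    refine (ENNReal.add_right_inj h3).1 ?_
    rw [← add_assoc, ← add_mul, hβ' n, one_mul]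
    rw [hu, h1]
    ring
  choose h hh using fun s => hlim fun n => u n s
  obtain ⟨G, hG⟩ := hlim fun n => ε n * V n origin
  refine ⟨G, h, le_of_tendsto' hG hV0, fun s => le_of_tendsto' (hh s) fun n => huW n s,
    fun s => ?_, fun s D t hD => ?_⟩
  · refine tendsto_nhds_unique (hG.add (hh s)) ?_
    have := tendsto_const_nhds (x := c s) |>.add (ENNReal.Tendsto.mul lim_β' (Or.inl one_ne_zero)
      (tendsto_bestMean g hh s) (Or.inr ENNReal.one_ne_top))
    rw [one_mul] at this
    exact this.congr fun n => (heq n s).symm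
  · have h1 : Tendsto (fun n => (ε n : ℝ≥0∞) * D + t) l (𝓝 (0 * D + t)) :=
      (ENNReal.Tendsto.mul_const lim_ε' (Or.inr ENNReal.coe_ne_top)).add tendsto_const_nhds
    rw [zero_mul, zero_add] at h1
    refine le_of_tendsto_of_tendsto' hG h1 fun n => ?_
    -- Minimality of the origin transfers the bound from an arbitrary initial state `s`.
    refine (mul_le_mul_right (hVmin n s) _).trans ?_
    change _ * (⨆ N, _) ≤ _
    rw [ENNReal.mul_iSup]
    exact iSup_le fun N => hD _ _ N (hβ n)

/-! ## Optimal stationary policies -/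

theorem sum_stateMean_stationary_le {g : ℕ → I} {c h : State → ℝ≥0∞} {G : ℝ≥0∞}
    {d : State → Action} (hd : ∀ s, c s + stepMean g h s (d s) ≤ G + h s) (s : State) (N : ℕ) :
    ∑ k ∈ Finset.range N, stateMean g (stationary d) s k c +
      stateMean g (stationary d) s N h ≤ N * G + h s := by
  induction N with
  | zero => simp [stateMean_zero]
  | succ N ih =>
    have h1 : stateMean g (stationary d) s N c + stateMean g (stationary d) s (N + 1) h ≤
        G + stateMean g (stationary d) s N h := by
      rw [stateMean_stationary_succ, stateMean, stateMean, ← expect_add,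
        ← expect_const (historyLaw g (stationary d) s N) G, stateMean, ← expect_add]
      exact expect_mono _ fun x => hd x.2
    rw [Finset.sum_range_succ, add_assoc]
    refine (add_le_add_right h1 _).trans ?_
    rw [add_left_comm]
    refine (add_le_add_right ih _).trans (le_of_eq ?_)
    push_cast
    ring

theorem limsup_average_le {e : ℕ → ℝ≥0∞} {G D : ℝ≥0∞} (hD : D ≠ ∞)
    (he : ∀ N : ℕ, ∑ k ∈ Finset.range N, e k ≤ N * G + D) :
    limsup (fun K : ℕ => (∑ k ∈ Finset.range K, e k) / (K : ℝ≥0∞)) atTop ≤ G := by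
  have h1 : Tendsto (fun K : ℕ => G + D / (K : ℝ≥0∞)) atTop (𝓝 (G + 0)) :=
    tendsto_const_nhds.add
      ((ENNReal.Tendsto.const_div ENNReal.tendsto_nat_nhds_top (Or.inr hD)).trans (by simp))
  rw [add_zero] at h1
  rw [← h1.limsup_eq]
  refine limsup_le_limsup ?_
  filter_upwards [eventually_ge_atTop 1] with K hK
  have hK0 : (K : ℝ≥0∞) ≠ 0 := by exact_mod_cast (by omega : K ≠ 0)
  refine (ENNReal.div_le_div_right (he K) _).trans (le_of_eq ?_)
  rw [ENNReal.add_div, mul_comm, ENNReal.mul_div_cancel_right hK0 (ENNReal.natCast_ne_top K)]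

/-- The constant `D` absorbs the initial stretch before the averages settle below `t`; starting at
`K₀ + 1` avoids division by zero. -/
theorem exists_sum_le_of_limsup_average_lt {e : ℕ → ℝ≥0∞} {t : ℝ≥0}
    (ht : limsup (fun K : ℕ => (∑ k ∈ Finset.range K, e k) / (K : ℝ≥0∞)) atTop < t) :
    ∃ D : ℝ≥0, ∀ N : ℕ, ∑ k ∈ Finset.range N, e k ≤ D + N * t := by
  obtain ⟨K₀, hK₀⟩ := eventually_atTop.1 (eventually_lt_of_limsup_lt ht)
  have h1 : ∀ K, K₀ + 1 ≤ K → ∑ k ∈ Finset.range K, e k ≤ K * t := fun K hK => by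
    have hK0 : (K : ℝ≥0∞) ≠ 0 := by exact_mod_cast (by omega : K ≠ 0)
    have := (hK₀ K (by omega)).le
    rwa [ENNReal.div_le_iff hK0 (ENNReal.natCast_ne_top K), mul_comm] at this
  refine ⟨(K₀ + 1 : ℕ) * t, fun N => ?_⟩
  rcases le_total N (K₀ + 1) with hN | hN
  · refine (Finset.sum_le_sum_of_subset (Finset.range_mono hN)).trans ((h1 _ le_rfl).trans ?_)
    push_cast
    exact le_self_add
  · exact (h1 N hN).trans le_add_self

theorem exists_optimal_stationary {g : ℕ → I} {c W : State → ℝ≥0∞}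
    (hmin : ∀ (β : ℝ≥0∞) (N : ℕ) (s : State), finValue g c β N origin ≤ finValue g c β N s)
    (hW : ∀ s, ∃ a, c s + stepMean g (Function.update W origin 0) s a ≤ W s)
    (hfin : ∀ s, W s ≠ ∞) :
    ∃ (G : ℝ≥0∞) (d : State → Action), G ≤ W origin ∧
      (∀ s, limsup (fun K : ℕ => (∑ k ∈ Finset.range K, stateMean g (stationary d) s k c) /
        (K : ℝ≥0∞)) atTop ≤ G) ∧
      ∀ (s : State) (π : Policy), G ≤ limsup (fun K : ℕ =>
        (∑ k ∈ Finset.range K, stateMean g π s k c) / (K : ℝ≥0∞)) atTop := by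
  obtain ⟨G, h, hG, hhW, heq, hle⟩ := exists_optimality_equation hmin hW hfin
  choose d hd using fun s => exists_stepMean_eq_bestMean g h s
  refine ⟨G, d, hG, fun s => ?_, fun s π => ?_⟩
  · refine limsup_average_le (ne_top_of_le_ne_top (hfin s) (hhW s)) fun N => ?_
    refine le_self_add.trans (sum_stateMean_stationary_le (h := h) (fun s' => ?_) s N)
    rw [hd, heq]
  · by_contra! hlt
    obtain ⟨t, ht, htG⟩ := ENNReal.lt_iff_exists_nnreal_btwn.1 hlt
    obtain ⟨D, hD⟩ := exists_sum_le_of_limsup_average_lt ht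
    refine htG.not_ge (hle s D t fun β ε N hβ => ?_)
    refine (mul_le_mul_right (finValue_le_sum g c β π s N) _).trans ?_
    exact discounted_sum_le hD hβ N

/-! ## Structure of the values for costs that increase with the quality index -/

/-- Coupling: under a common action both states have the same failure probability and the same state
after a success, while the states after a failure remain ordered. -/
theorem finValue_mono_quality {g : ℕ → I} {c : ℕ → ℝ≥0∞} (hc : Monotone c) (β : ℝ≥0∞) (N : ℕ)
    {r q q' : ℕ} (hr : r ≤ q) (hq : q ≤ q') :
    finValue g (fun s => c s.1.2) β N ⟨(r, q), hr⟩ ≤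
      finValue g (fun s => c s.1.2) β N ⟨(r, q'), hr.trans hq⟩ := by
  induction N generalizing r q q' with
  | zero => exact le_rfl
  | succ N ih =>
    have h1 : ∀ a : Action, stepMean g (finValue g (fun s => c s.1.2) β N) ⟨(r, q), hr⟩ a ≤
        stepMean g (finValue g (fun s => c s.1.2) β N) ⟨(r, q'), hr.trans hq⟩ a := fun a => by
      unfold stepMean
      refine add_le_add le_rfl (mul_le_mul_right ?_ _)
      exact ih (nextR_le ⟨(r, q), hr⟩ a) (by simpa using hq)
    exact add_le_add (hc hq) (mul_le_mul_right (min_le_min (h1 0) (h1 1)) _)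

/-- Action `0` in `(0,x)` beats either action in `(r,q)`. Against action `0` the outcomes are
coupled. Against action `1` the opponent lands at count `r + 1` and `(0,x)` moves to quality at most
`r + 1`, so every pair of outcomes is ordered by induction and the values of `g` are irrelevant. -/
theorem finValue_new_le {g : ℕ → I} {c : ℕ → ℝ≥0∞} (hc : Monotone c) (β : ℝ≥0∞) (N : ℕ)
    {r q x : ℕ} (hr : r ≤ q) (hx : x ≤ r) :
    finValue g (fun s => c s.1.2) β N ⟨(0, x), x.zero_le⟩ ≤
      finValue g (fun s => c s.1.2) β N ⟨(r, q), hr⟩ := by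
  induction N generalizing r q x with
  | zero => exact le_rfl
  | succ N ih =>
    refine add_le_add (hc (hx.trans hr)) (mul_le_mul_right ((bestMean_le g _ _ 0).trans
      (le_min ?_ ?_)) _)
    · unfold stepMean
      refine add_le_add le_rfl (mul_le_mul_right ?_ _)
      exact finValue_mono_quality hc β N _ (by simpa using hx.trans hr)
    · refine stepMean_le fun b => le_stepMean fun b' => ?_
      have h2 : (nextState ⟨(0, x), x.zero_le⟩ 0 b).1.1 = 0 := by cases b <;> rfl
      have h3 : (nextState ⟨(0, x), x.zero_le⟩ 0 b).1.2 ≤ r + 1 := by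
        cases b
        · exact Nat.zero_le _
        · exact Nat.succ_le_succ hx
      have h4 : (nextState ⟨(r, q), hr⟩ 1 b').1.1 = r + 1 := by cases b' <;> rfl
      generalize nextState ⟨(0, x), x.zero_le⟩ 0 b = s at h2 h3
      generalize nextState ⟨(r, q), hr⟩ 1 b' = s' at h4
      obtain ⟨⟨r₁, q₁⟩, h₁⟩ := s
      obtain ⟨⟨r₂, q₂⟩, h₂⟩ := s'
      dsimp only at h2 h3 h4
      subst h2 h4
      exact ih h₂ h3

theorem finValue_origin_le {g : ℕ → I} {c : ℕ → ℝ≥0∞} (hc : Monotone c) (β : ℝ≥0∞) (N : ℕ)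
    (s : State) : finValue g (fun s => c s.1.2) β N origin ≤ finValue g (fun s => c s.1.2) β N s :=
  finValue_new_le hc β N s.2 (Nat.zero_le _)

/-- For costs of exponential growth with rate `a` and failure probabilities of retransmissions
below `γ < 1 / a`, the policy that retransmits until the first success gives a bound on the
expected cost until the visit to the origin. -/
theorem exists_drift_function {g : ℕ → I} {c : ℕ → ℝ≥0∞} {K a γ : ℝ≥0}
    (hc : ∀ q, c q ≤ K * a ^ q) (hγ : ∀ r, failProb g (r + 1) ≤ γ) (hγa : γ * a < 1)
    (hg0 : failProb g 0 < 1) :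
    ∃ W : State → ℝ≥0∞, (∀ s, W s ≠ ∞) ∧
      ∀ s, ∃ b, c s.1.2 + stepMean g (Function.update W origin 0) s b ≤ W s := by
  set p₀ : ℝ≥0 := unitInterval.toNNReal (g 0) with hp₀
  have hp₀1 : p₀ < 1 := by
    have : (p₀ : ℝ≥0∞) < 1 := hg0
    exact_mod_cast this
  obtain ⟨δ, hδ0, hδ⟩ : ∃ δ : ℝ≥0, δ ≠ 0 ∧ γ * a + δ = 1 :=
    ⟨1 - γ * a, (tsub_pos_of_lt hγa).ne', add_tsub_cancel_of_le hγa.le⟩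
  obtain ⟨η, hη0, hη⟩ : ∃ η : ℝ≥0, η ≠ 0 ∧ p₀ + η = 1 :=
    ⟨1 - p₀, (tsub_pos_of_lt hp₀1).ne', add_tsub_cancel_of_le hp₀1.le⟩
  -- Off the diagonal, `u a^q` pays for the current run of failures, `v a^r` for the diagonal state
  -- reached at its end, and `w` for later rounds. The constants solve the linear equations `hu`,
  -- `hv`, `hw`, solvable since `γ a < 1` and `p₀ < 1`.
  let u : ℝ≥0 := K / δ
  let x : ℝ≥0 := K + p₀ * u * a
  let v : ℝ≥0 := x * a / δ
  let w : ℝ≥0 := p₀ * v / η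
  have hu : K + γ * a * u = u := by
    have : u * δ = K := div_mul_cancel₀ _ hδ0
    calc K + γ * a * u = (γ * a + δ) * u := by rw [← this]; ring
      _ = u := by rw [hδ, one_mul]
  have hv : x * a + γ * a * v = v := by
    have : v * δ = x * a := div_mul_cancel₀ _ hδ0
    calc x * a + γ * a * v = (γ * a + δ) * v := by rw [← this]; ring
      _ = v := by rw [hδ, one_mul]
  have hw : p₀ * v + p₀ * w = w := by
    have : w * η = p₀ * v := div_mul_cancel₀ _ hη0
    calc p₀ * v + p₀ * w = (p₀ + η) * w := by rw [← this]; ring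
      _ = w := by rw [hη, one_mul]
  let W : State → ℝ≥0 := fun s =>
    if s.1.2 = s.1.1 then x * a ^ s.1.1 + w else u * a ^ s.1.2 + v * a ^ s.1.1 + w
  have hupd : ∀ s, Function.update (fun s => (W s : ℝ≥0∞)) origin 0 s ≤ W s := fun s => by
    by_cases hs : s = origin
    · simp [hs]
    · rw [Function.update_of_ne hs]
  refine ⟨fun s => W s, fun s => ENNReal.coe_ne_top, fun s => ?_⟩
  obtain ⟨⟨r, q⟩, hrq⟩ := s
  dsimp only at hrq
  by_cases hq : q = r
  · subst hq
    -- On the diagonal a new transmission is made: success hits the origin, where the updated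
    -- function vanishes, and failure leads to `(0, q + 1)`.
    refine ⟨0, ?_⟩
    have h1 : stepMean g (Function.update (fun s => (W s : ℝ≥0∞)) origin 0) ⟨(q, q), hrq⟩ 0 ≤
        p₀ * ((u * a ^ (q + 1) + v + w : ℝ≥0) : ℝ≥0∞) := by
      change succProb g 0 * Function.update (fun s => (W s : ℝ≥0∞)) origin 0 origin +
        p₀ * Function.update (fun s => (W s : ℝ≥0∞)) origin 0 ⟨(0, q + 1), _⟩ ≤ _
      rw [Function.update_self, mul_zero, zero_add]
      gcongr
      refine (hupd _).trans ?_
      simp [W]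
    refine (add_le_add (hc q) h1).trans ?_
    norm_cast
    refine ENNReal.coe_le_coe.2 (le_of_eq ?_)
    simp only [W, if_true]
    calc K * a ^ q + p₀ * (u * a ^ (q + 1) + v + w)
        = (K + p₀ * u * a) * a ^ q + (p₀ * v + p₀ * w) := by ring
      _ = x * a ^ q + w := by rw [hw]
  · refine ⟨1, ?_⟩
    set p : ℝ≥0 := unitInterval.toNNReal (g (r + 1)) with hp
    set p' : ℝ≥0 := unitInterval.toNNReal (unitInterval.symm (g (r + 1))) with hp'
    have hpp : p' + p = 1 := by
      have : (p' : ℝ≥0∞) + p = 1 := succProb_add_failProb g (r + 1)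
      exact_mod_cast this
    have hpγ : p ≤ γ := by
      have : (p : ℝ≥0∞) ≤ γ := hγ r
      exact_mod_cast this
    have hp'1 : p' ≤ 1 := hpp ▸ le_self_add
    have h1 : stepMean g (Function.update (fun s => (W s : ℝ≥0∞)) origin 0) ⟨(r, q), hrq⟩ 1 ≤
        p' * ((x * a ^ (r + 1) + w : ℝ≥0) : ℝ≥0∞) +
          p * ((u * a ^ (q + 1) + v * a ^ (r + 1) + w : ℝ≥0) : ℝ≥0∞) := by
      refine (stepMean_mono g hupd _ _).trans (le_of_eq ?_)
      change (p' : ℝ≥0∞) * W ⟨(r + 1, r + 1), _⟩ + p * W ⟨(r + 1, q + 1), _⟩ = _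
      simp [W, hq]
    refine (add_le_add (hc q) h1).trans ?_
    norm_cast
    refine ENNReal.coe_le_coe.2 ?_
    simp only [W, hq, if_false]
    calc K * a ^ q + (p' * (x * a ^ (r + 1) + w) + p * (u * a ^ (q + 1) + v * a ^ (r + 1) + w))
        = K * a ^ q + p' * (x * a ^ (r + 1)) + p * (u * a ^ (q + 1)) + p * (v * a ^ (r + 1)) +
          (p' + p) * w := by ring
      _ ≤ K * a ^ q + 1 * (x * a ^ (r + 1)) + γ * (u * a ^ (q + 1)) + γ * (v * a ^ (r + 1)) +
          1 * w := by
          rw [hpp]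
          gcongr
      _ = (K + γ * a * u) * a ^ q + (x * a + γ * a * v) * a ^ r + w := by ring
      _ = u * a ^ q + v * a ^ r + w := by rw [hu, hv]

/-! ## The error covariances of the local filter -/

theorem predict_posSemidef {n : ℕ} (A : Matrix (Fin n) (Fin n) ℝ) {Q X : Matrix (Fin n) (Fin n) ℝ}
    (hQ : Q.PosSemidef) (hX : X.PosSemidef) : (predict A Q X).PosSemidef := by
  have := hX.mul_mul_conjTranspose_same A
  rw [Matrix.conjTranspose_eq_transpose_of_trivial] at this
  exact this.add hQ

theorem innovationCov_posSemidef {n m : ℕ} (A : Matrix (Fin n) (Fin n) ℝ)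
    (C : Matrix (Fin m) (Fin n) ℝ) {Q P : Matrix (Fin n) (Fin n) ℝ}
    {R : Matrix (Fin m) (Fin m) ℝ} (hQ : Q.PosSemidef) (hR : R.PosSemidef) (hP : P.PosSemidef) :
    (innovationCov A C Q R P).PosSemidef := by
  have := (predict_posSemidef A hQ hP).mul_mul_conjTranspose_same C
  rw [Matrix.conjTranspose_eq_transpose_of_trivial] at this
  exact this.add hR

/-- The Joseph form of the covariance update. -/
theorem update_eq_joseph {n m : ℕ} (M : Matrix (Fin n) (Fin n) ℝ) (C : Matrix (Fin m) (Fin n) ℝ)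
    (R : Matrix (Fin m) (Fin m) ℝ) (K : Matrix (Fin n) (Fin m) ℝ)
    (hK : K * (C * M * C.transpose + R) = M * C.transpose) :
    (1 - K * C) * M =
      (1 - K * C) * M * (1 - K * C).transpose + K * R * K.transpose := by
  have h : (1 - K * C) * M * C.transpose = K * R := by
    rw [Matrix.sub_mul, Matrix.sub_mul, Matrix.one_mul, ← hK]
    simp only [Matrix.mul_add, Matrix.mul_assoc]
    abel
  rw [Matrix.transpose_sub, Matrix.transpose_mul, Matrix.transpose_one, Matrix.mul_sub,
    Matrix.mul_one, ← Matrix.mul_assoc _ C.transpose, h]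
  abel

theorem kalmanCov_posSemidef {n m : ℕ} {A : Matrix (Fin n) (Fin n) ℝ}
    {C : Matrix (Fin m) (Fin n) ℝ} {Q S : Matrix (Fin n) (Fin n) ℝ} {R : Matrix (Fin m) (Fin m) ℝ}
    (hQ : Q.PosSemidef) (hR : R.PosSemidef) (hS : S.PosSemidef)
    (hinv : ∀ k : ℕ, IsUnit (innovationCov A C Q R (kalmanCov A C Q R S k))) (k : ℕ) :
    (kalmanCov A C Q R S k).PosSemidef := by
  induction k with
  | zero => exact hS
  | succ k ih =>
    have hK : kalmanGain A C Q R (kalmanCov A C Q R S k) *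
        innovationCov A C Q R (kalmanCov A C Q R S k) =
        predict A Q (kalmanCov A C Q R S k) * C.transpose := by
      rw [kalmanGain, Matrix.mul_assoc,
        Matrix.nonsing_inv_mul _ ((Matrix.isUnit_iff_isUnit_det _).1 (hinv k)), Matrix.mul_one]
    rw [kalmanCov, update_eq_joseph _ _ _ _ hK, ← Matrix.conjTranspose_eq_transpose_of_trivial,
      ← Matrix.conjTranspose_eq_transpose_of_trivial]
    exact ((predict_posSemidef A hQ ih).mul_mul_conjTranspose_same _).add
      (hR.mul_mul_conjTranspose_same _)

/-- A measurement cannot increase the covariance: the difference is `(C M)ᵀ (C M Cᵀ + R)⁻¹ (C M)`.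
-/
theorem predict_sub_kalmanCov_succ_posSemidef {n m : ℕ} {A : Matrix (Fin n) (Fin n) ℝ}
    {C : Matrix (Fin m) (Fin n) ℝ} {Q S : Matrix (Fin n) (Fin n) ℝ} {R : Matrix (Fin m) (Fin m) ℝ}
    (hQ : Q.PosSemidef) (hR : R.PosSemidef) (hS : S.PosSemidef)
    (hinv : ∀ k : ℕ, IsUnit (innovationCov A C Q R (kalmanCov A C Q R S k))) (k : ℕ) :
    (predict A Q (kalmanCov A C Q R S k) - kalmanCov A C Q R S (k + 1)).PosSemidef := by
  have hP := kalmanCov_posSemidef hQ hR hS hinv k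
  have hM := predict_posSemidef A hQ hP
  have hMT : (predict A Q (kalmanCov A C Q R S k)).transpose =
      predict A Q (kalmanCov A C Q R S k) := by
    rw [← Matrix.conjTranspose_eq_transpose_of_trivial]
    exact hM.isHermitian
  have h := (innovationCov_posSemidef A C hQ hR hP).inv.conjTranspose_mul_mul_same
    (C * predict A Q (kalmanCov A C Q R S k))
  rw [Matrix.conjTranspose_eq_transpose_of_trivial, Matrix.transpose_mul, hMT] at h
  rw [kalmanCov, Matrix.sub_mul, Matrix.one_mul, sub_sub_cancel, kalmanGain, Matrix.mul_assoc _ C]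
  exact h

theorem continuous_predict {n : ℕ} (A Q : Matrix (Fin n) (Fin n) ℝ) :
    Continuous (predict A Q) := by
  unfold predict
  fun_prop

theorem trace_predict_sub_limit_nonneg {n m : ℕ} {A : Matrix (Fin n) (Fin n) ℝ}
    {C : Matrix (Fin m) (Fin n) ℝ} {Q S P₀ : Matrix (Fin n) (Fin n) ℝ}
    {R : Matrix (Fin m) (Fin m) ℝ} (hQ : Q.PosSemidef) (hR : R.PosSemidef) (hS : S.PosSemidef)
    (hinv : ∀ k : ℕ, IsUnit (innovationCov A C Q R (kalmanCov A C Q R S k)))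
    (hP₀ : Tendsto (kalmanCov A C Q R S) atTop (𝓝 P₀)) (B : Matrix (Fin n) (Fin n) ℝ) :
    0 ≤ (B * (predict A Q P₀ - P₀) * B.transpose).trace := by
  have h1 : Tendsto (fun k => predict A Q (kalmanCov A C Q R S k) - kalmanCov A C Q R S (k + 1))
      atTop (𝓝 (predict A Q P₀ - P₀)) :=
    (((continuous_predict A Q).tendsto P₀).comp hP₀).sub (hP₀.comp (tendsto_add_atTop_nat 1))
  have h2 : Continuous fun X : Matrix (Fin n) (Fin n) ℝ => (B * X * B.transpose).trace := by
    fun_prop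
  refine ge_of_tendsto' ((h2.tendsto _).comp h1) fun k => ?_
  have := (predict_sub_kalmanCov_succ_posSemidef hQ hR hS hinv k).mul_mul_conjTranspose_same B
  rw [Matrix.conjTranspose_eq_transpose_of_trivial] at this
  exact this.trace_nonneg

/-- This form gives both the monotonicity of the costs and, after summation, their growth rate. -/
theorem predict_iterate_succ_sub {n : ℕ} (A Q X : Matrix (Fin n) (Fin n) ℝ) (q : ℕ) :
    (predict A Q)^[q + 1] X - (predict A Q)^[q] X =
      A ^ q * (predict A Q X - X) * (A ^ q).transpose := by
  induction q with
  | zero => simp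
  | succ q ih =>
    have h : ∀ Y Z, predict A Q Y - predict A Q Z = A * (Y - Z) * A.transpose := fun Y Z => by
      rw [predict, predict, add_sub_add_right_eq_sub, ← Matrix.sub_mul, ← Matrix.mul_sub]
    rw [Function.iterate_succ_apply' _ (q + 1), Function.iterate_succ_apply' _ q, h,
      ← Function.iterate_succ_apply' (predict A Q) q X, ih, pow_succ' A q, Matrix.transpose_mul]
    simp only [Matrix.mul_assoc]

/-! ## The growth of the costs -/

section Growth

attribute [local instance] Matrix.frobeniusNormedRing Matrix.frobeniusNormedAlgebra

/-- Ensures that `toReal` in `specRadius` does not send an infinite value to `0`. -/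
theorem spectralRadius_ne_top {n : ℕ} (A : Matrix (Fin n) (Fin n) ℂ) : spectralRadius ℂ A ≠ ∞ := by
  have : CompleteSpace (Matrix (Fin n) (Fin n) ℂ) := FiniteDimensional.complete ℂ _
  have h := spectrum.pow_norm_pow_one_div_tendsto_nhds_spectralRadius A
  refine ne_top_of_le_ne_top (ENNReal.ofReal_ne_top (r := ‖A‖)) (le_of_tendsto h ?_)
  -- The exponent `0` is excluded: the Frobenius norm of the identity is `√n`.
  filter_upwards [eventually_ge_atTop 1] with k hk
  refine ENNReal.ofReal_le_ofReal ?_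
  have hk0 : (k : ℝ) ≠ 0 := by positivity
  calc ‖A ^ k‖ ^ (1 / k : ℝ) ≤ (‖A‖ ^ k) ^ (1 / k : ℝ) := by
        gcongr
        exact norm_pow_le' A hk
    _ = ‖A‖ := by rw [one_div, Real.pow_rpow_inv_natCast (norm_nonneg _) (by omega)]

theorem exists_norm_pow_le {n : ℕ} (A : Matrix (Fin n) (Fin n) ℝ) {b : ℝ} (hb : specRadius A < b) :
    ∃ L, ∀ j : ℕ, ‖A ^ j‖ ≤ L * b ^ j := by
  have hb0 : 0 < b := lt_of_le_of_lt ENNReal.toReal_nonneg hb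
  have : CompleteSpace (Matrix (Fin n) (Fin n) ℂ) := FiniteDimensional.complete ℂ _
  have h := spectrum.pow_norm_pow_one_div_tendsto_nhds_spectralRadius
    (A.map fun x : ℝ => (x : ℂ))
  have hlt : spectralRadius ℂ (A.map fun x : ℝ => (x : ℂ)) < ENNReal.ofReal b :=
    (ENNReal.lt_ofReal_iff_toReal_lt (spectralRadius_ne_top _)).2 hb
  have hpow : ∀ j : ℕ, ‖(A.map fun x : ℝ => (x : ℂ)) ^ j‖ = ‖A ^ j‖ := fun j => by
    have : (A.map fun x : ℝ => (x : ℂ)) ^ j = (A ^ j).map fun x : ℝ => (x : ℂ) :=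
      (map_pow (Complex.ofRealHom.mapMatrix) A j).symm
    rw [this]
    exact Matrix.frobenius_norm_map_eq _ _ fun x => Complex.norm_real x
  obtain ⟨N, hN⟩ := eventually_atTop.1 (h.eventually_lt_const hlt)
  -- By Gelfand's formula the ratio is at most `1` beyond `N`; the sum dominates the finitely many
  -- earlier ratios.
  refine ⟨1 + ∑ i ∈ Finset.range (N + 1), ‖A ^ i‖ / b ^ i, fun j => ?_⟩
  have hbj : 0 < b ^ j := pow_pos hb0 j
  rw [← div_le_iff₀ hbj]
  have hnn : ∀ i ∈ Finset.range (N + 1), 0 ≤ ‖A ^ i‖ / b ^ i := fun i _ => by positivity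
  rcases lt_or_ge j (N + 1) with hj | hj
  · have := Finset.single_le_sum hnn (Finset.mem_range.2 hj)
    linarith
  · have h1 := hN j (by omega)
    rw [hpow, ENNReal.ofReal_lt_ofReal_iff hb0] at h1
    have h2 : ‖A ^ j‖ ≤ b ^ j := by
      have h3 := pow_le_pow_left₀ (by positivity) h1.le j
      rwa [one_div, Real.rpow_inv_natCast_pow (norm_nonneg _) (by omega)] at h3
    have h4 : ‖A ^ j‖ / b ^ j ≤ 1 := (div_le_one hbj).2 h2
    have := Finset.sum_nonneg hnn
    linarith

theorem predict_iterate_eq {n : ℕ} (A Q X : Matrix (Fin n) (Fin n) ℝ) (q : ℕ) :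
    (predict A Q)^[q] X =
      X + ∑ j ∈ Finset.range q, A ^ j * (predict A Q X - X) * (A ^ j).transpose := by
  simp only [← predict_iterate_succ_sub, Finset.sum_range_sub (fun i => (predict A Q)^[i] X)]
  simp

theorem trace_le_frobenius_norm {n : ℕ} (X : Matrix (Fin n) (Fin n) ℝ) :
    X.trace ≤ n * ‖X‖ := by
  have h : ∀ i, X i i ≤ ‖X‖ := fun i => by
    have h1 : ‖X i i‖ ^ (2 : ℝ) ≤ ∑ i, ∑ j, ‖X i j‖ ^ (2 : ℝ) :=
      (Finset.single_le_sum (f := fun j => ‖X i j‖ ^ (2 : ℝ)) (fun _ _ => by positivity)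
        (Finset.mem_univ i)).trans
        (Finset.single_le_sum (f := fun i => ∑ j, ‖X i j‖ ^ (2 : ℝ)) (fun _ _ => by positivity)
          (Finset.mem_univ i))
    calc X i i ≤ ‖X i i‖ := Real.le_norm_self _
      _ = (‖X i i‖ ^ (2 : ℝ)) ^ (1 / 2 : ℝ) := by
          rw [← Real.rpow_mul (norm_nonneg _)]
          norm_num
      _ ≤ (∑ i, ∑ j, ‖X i j‖ ^ (2 : ℝ)) ^ (1 / 2 : ℝ) := by gcongr
      _ = ‖X‖ := (Matrix.frobenius_norm_def X).symm
  calc X.trace ≤ ∑ _i : Fin n, ‖X‖ := Finset.sum_le_sum fun i _ => h i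
    _ = n * ‖X‖ := by simp

theorem exists_trace_predict_iterate_le {n : ℕ} (A Q X : Matrix (Fin n) (Fin n) ℝ) {b : ℝ}
    (hb : specRadius A < b) (hb1 : 1 < b) :
    ∃ K : ℝ≥0, ∀ q : ℕ, ((predict A Q)^[q + 1] X).trace ≤ K * (b ^ 2) ^ q := by
  obtain ⟨L, hL⟩ := exists_norm_pow_le A hb
  set a := b ^ 2 with ha
  have ha1 : 1 < a := one_lt_pow₀ hb1 two_ne_zero
  have hterm : ∀ j : ℕ, ‖A ^ j * (predict A Q X - X) * (A ^ j).transpose‖ ≤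
      L ^ 2 * ‖predict A Q X - X‖ * a ^ j := fun j => by
    have h1 := hL j
    calc ‖A ^ j * (predict A Q X - X) * (A ^ j).transpose‖
        ≤ ‖A ^ j‖ * ‖predict A Q X - X‖ * ‖(A ^ j).transpose‖ := norm_mul₃_le
      _ = ‖A ^ j‖ ^ 2 * ‖predict A Q X - X‖ := by
          rw [show ‖(A ^ j).transpose‖ = ‖A ^ j‖ from Matrix.frobenius_norm_transpose _]
          ring
      _ ≤ (L * b ^ j) ^ 2 * ‖predict A Q X - X‖ := by gcongr
      _ = L ^ 2 * ‖predict A Q X - X‖ * a ^ j := by rw [ha]; ring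
  -- Since `a > 1`, the geometric sum is comparable to its last term; this is why `b > 1` is
  -- required.
  have hsum : ∀ q : ℕ, ∑ j ∈ Finset.range (q + 1), a ^ j ≤ a / (a - 1) * a ^ q := fun q => by
    rw [geom_sum_eq ha1.ne', pow_succ, div_mul_eq_mul_div]
    gcongr
    · linarith
  let D := L ^ 2 * ‖predict A Q X - X‖
  have hD : 0 ≤ D := by positivity
  have haa : 0 ≤ a / (a - 1) := div_nonneg (by linarith) (by linarith)
  refine ⟨⟨n * (‖X‖ + D * (a / (a - 1))), by positivity⟩, fun q => ?_⟩
  have hXa : ‖X‖ ≤ ‖X‖ * a ^ q := le_mul_of_one_le_right (norm_nonneg _) (one_le_pow₀ ha1.le)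
  calc ((predict A Q)^[q + 1] X).trace ≤ n * ‖(predict A Q)^[q + 1] X‖ :=
        trace_le_frobenius_norm _
    _ ≤ n * (‖X‖ + ∑ j ∈ Finset.range (q + 1), D * a ^ j) := by
        gcongr
        rw [predict_iterate_eq]
        exact (norm_add_le _ _).trans (add_le_add le_rfl
          ((norm_sum_le _ _).trans (Finset.sum_le_sum fun j _ => hterm j)))
    _ ≤ n * (‖X‖ * a ^ q + D * (a / (a - 1) * a ^ q)) := by
        rw [← Finset.mul_sum]
        gcongr
        exact hsum q
    _ = n * (‖X‖ + D * (a / (a - 1))) * a ^ q := by ring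

end Growth

theorem exists_rate {γ ρ : ℝ} (hγ : γ < 1) (h : γ * ρ ^ 2 < 1) :
    ∃ b, ρ < b ∧ 1 < b ∧ γ * b ^ 2 < 1 := by
  have hmax : γ * (max ρ 1) ^ 2 < 1 := by
    rcases max_choice ρ 1 with h1 | h1 <;> rw [h1]
    · exact h
    · simpa using hγ
  have hc : Continuous fun b : ℝ => γ * b ^ 2 := by fun_prop
  have hev : ∀ᶠ b in 𝓝[>] (max ρ 1), γ * b ^ 2 < 1 :=
    ((hc.tendsto _).eventually_lt_const hmax).filter_mono nhdsWithin_le_nhds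
  obtain ⟨b, hb, hb'⟩ := (hev.and self_mem_nhdsWithin).exists
  exact ⟨b, (le_max_left _ _).trans_lt hb', (le_max_right _ _).trans_lt hb', hb⟩

end

end HARQ

/-! ### The main theorem: costs and drift of the remote estimation model -/

theorem theorem1 {n m : ℕ}
    (A : Matrix (Fin n) (Fin n) ℝ) (C : Matrix (Fin m) (Fin n) ℝ)
    (Q : Matrix (Fin n) (Fin n) ℝ) (R : Matrix (Fin m) (Fin m) ℝ)
    (S P₀ : Matrix (Fin n) (Fin n) ℝ)
    (hQ : Q.PosSemidef) (hR : R.PosSemidef) (hS : S.PosSemidef)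
    (hinv : ∀ k : ℕ, IsUnit (HARQ.innovationCov A C Q R (HARQ.kalmanCov A C Q R S k)))
    (hP₀ : Tendsto (HARQ.kalmanCov A C Q R S) atTop (𝓝 P₀))
    (g : ℕ → I) (hg0 : g 0 < 1) (hg : ∀ r : ℕ, 0 < r → g r < g 0)
    (hstab : (⨆ r : {r : ℕ // 0 < r}, (g r : ℝ)) * HARQ.specRadius A ^ 2 < 1) :
    ∃ d : HARQ.State → HARQ.Action,
      (∀ (s : HARQ.State) (π : HARQ.Policy),
        HARQ.avgCost A Q P₀ g (HARQ.stationary d) s ≤ HARQ.avgCost A Q P₀ g π s) ∧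
      ∃ B : ℝ≥0, ∀ s : HARQ.State,
        HARQ.avgCost A Q P₀ g (HARQ.stationary d) s ≤ (B : ℝ≥0∞) := by
  have : Nonempty {r : ℕ // 0 < r} := ⟨⟨1, one_pos⟩⟩
  set γ : ℝ := ⨆ r : {r : ℕ // 0 < r}, (g r : ℝ) with hγ
  have hbdd : BddAbove (Set.range fun r : {r : ℕ // 0 < r} => (g r : ℝ)) :=
    ⟨1, by rintro _ ⟨r, rfl⟩; exact (g r).2.2⟩
  have hgγ : ∀ r, (g (r + 1) : ℝ) ≤ γ := fun r => le_ciSup hbdd ⟨r + 1, r.succ_pos⟩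
  have hγ0 : 0 ≤ γ := (g 1).2.1.trans (hgγ 0)
  -- The supremum may equal `g 0`, so strictness comes from `g 0 < 1`.
  have hγ1 : γ < 1 :=
    (ciSup_le (c := (g 0 : ℝ)) fun r : {r : ℕ // 0 < r} => (hg r r.2).le).trans_lt hg0
  obtain ⟨b, hρb, hb1, hγb⟩ := HARQ.exists_rate hγ1 hstab
  obtain ⟨K, hK⟩ := HARQ.exists_trace_predict_iterate_le A Q P₀ hρb hb1
  let c : ℕ → ℝ≥0∞ := fun q => ENNReal.ofReal ((HARQ.predict A Q)^[q + 1] P₀).trace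
  have hc : Monotone c := monotone_nat_of_le_succ fun q => by
    refine ENNReal.ofReal_le_ofReal (sub_nonneg.1 ?_)
    rw [← Matrix.trace_sub, HARQ.predict_iterate_succ_sub]
    exact HARQ.trace_predict_sub_limit_nonneg hQ hR hS hinv hP₀ _
  have hb0 : 0 ≤ b ^ 2 := sq_nonneg b
  have hcK : ∀ q, c q ≤ K * ((b ^ 2).toNNReal : ℝ≥0∞) ^ q := fun q => by
    refine ENNReal.ofReal_le_of_le_toReal ?_
    simpa [hb0] using hK q
  obtain ⟨W, hWfin, hW⟩ := HARQ.exists_drift_function (g := g) (γ := γ.toNNReal) hcK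
    (fun r => by
      refine ENNReal.coe_le_coe.2 ?_
      rw [← NNReal.coe_le_coe, Real.coe_toNNReal _ hγ0]
      exact hgγ r)
    (by
      rw [← NNReal.coe_lt_coe]
      push_cast
      rwa [Real.coe_toNNReal _ hγ0, Real.coe_toNNReal _ hb0])
    (by
      refine ENNReal.coe_lt_one_iff.2 ?_
      rw [← NNReal.coe_lt_coe]
      exact hg0)
  obtain ⟨G, d, hG, hd, hπ⟩ := HARQ.exists_optimal_stationary (HARQ.finValue_origin_le hc) hW hWfin
  have hcost : ∀ (π : HARQ.Policy) (s : HARQ.State), HARQ.avgCost A Q P₀ g π s =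
      limsup (fun N : ℕ => (∑ k ∈ Finset.range N,
        HARQ.stateMean g π s k fun s => c s.1.2) / (N : ℝ≥0∞)) atTop := fun π s => by
    simp only [HARQ.avgCost, HARQ.expCost_eq_stateMean]
    rfl
  refine ⟨d, fun s π => ?_, (W HARQ.origin).toNNReal, fun s => ?_⟩
  · rw [hcost, hcost]
    exact (hd s).trans (hπ s π)
  · rw [hcost, ENNReal.coe_toNNReal (hWfin _)]
    exact (hd s).trans hG
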